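/- **Theorem 1 (zero duality gap).** Let $\mathcal X\subset\mathbb R^p$ and $\mathcal W\subset\mathbb R$ be compact, let $x_1,\dots,x_N\in\mathcal X$, $y_1,\dots,y_N\in\mathbb R$ and $\gamma\ge 0$. Let $c:\mathbb R\times\mathbb R\to\mathbb R$ be a loss such that $c(\cdot,y_i)$ is convex for every $i$. Let $k(x,z;w)$ be a real-valued kernel without point masses, that is, each section $(z,w)\mapsto k(x_i,z;w)$ is a genuine Lebesgue-measurable function on $\mathcal X\times\mathcal W$ (not a distribution containing Dirac deltas), integrated against Lebesgue measure. Let $\mathcal A$ be the set of all $\alpha\in L_2(\mathcal X\times\mathcal W)$ for which the integrals $$f_\alpha(x_i)=\int_{\mathcal X\times\mathcal W}\alpha(z,w)\,k(x_i,z;w)\,dz\,dw,\qquad i=1,\dots,N,$$ exist (so $\mathcal A=L_2(\mathcal X\times\mathcal W)$ if the sections $k(x_i,\cdot;\cdot)$ are square integrable). Write $\|\alpha\|_{L_0}$ for the Lebesgue measure of $\{(z,w)\in\mathcal X\times\mathcal W:\alpha(z,w)\ne 0\}$. Consider the sparse functional program $$P=\inf_{\alpha\in\mathcal A,\ \hat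 y\in\mathbb R^N}\ \tfrac12\|\alpha\|_{L_2}^2+\gamma\|\alpha\|_{L_0}\quad\text{subject to}\quad c(\hat y_i,y_i)\le 0,\quad \hat y_i=f_\alpha(x_i),\quad i=1,\dots,N,$$ its Lagrangian $$\mathcal L(\alpha,\hat y,\lambda,\mu)=\tfrac12\|\alpha\|_{L_2}^2+\gamma\|\alpha\|_{L_0}-\sum_{i=1}^N\lambda_i f_\alpha(x_i)+\sum_{i=1}^N\lambda_i\hat y_i+\sum_{i=1}^N\mu_i\,c(\hat y_i,y_i),$$ and the dual problem $$D=\sup_{\lambda\in\mathbb R^N,\ \mu\in\mathbb R^N_+}\ \inf_{\alpha\in\mathcal A,\ \hat y\in\mathbb R^N}\mathcal L(\alpha,\hat y,\lambda,\mu).$$ Assume Slater's condition: there is $\alpha\in\mathcal A$ with $c(f_\alpha(x_i),y_i)<0$ for all $i=1,\dots,N$. Then $P$ and $D$ are finite and the duality gap vanishes: $P-D=0$. -/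

import Mathlib

open MeasureTheory

noncomputable section

namespace SFP

/-- Centers `z ∈ ℝ^p` paired with kernel parameters `w ∈ ℝ`. -/
abbrev Pt (p : ℕ) : Type := EuclideanSpace ℝ (Fin p) × ℝ

/-- Lebesgue measure `dz dw` restricted to `X × W`. -/
abbrev leb {p : ℕ} (X : Set (EuclideanSpace ℝ (Fin p))) (W : Set ℝ) : Measure (Pt p) :=
  (volume : Measure (Pt p)).restrict (X ×ˢ W)

/-- The coefficient space `L²(X × W)`. -/
abbrev Coef {p : ℕ} (X : Set (EuclideanSpace ℝ (Fin p))) (W : Set ℝ) : Type :=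
  Lp ℝ 2 (leb X W)

variable {p N : ℕ} {X : Set (EuclideanSpace ℝ (Fin p))} {W : Set ℝ}

/-- The "`L⁰`-norm": the measure of the set where `α ≠ 0`. -/
def l0 (α : Coef X W) : ℝ := (leb X W).real {v | α v ≠ 0}

/-- The objective `½ ‖α‖²_{L²} + γ ‖α‖_{L⁰}`. -/
def objective (γ : ℝ) (α : Coef X W) : ℝ := 1 / 2 * ‖α‖ ^ 2 + γ * l0 α

/-- All the integrals `∫ α(z,w) k(x_i, z; w) dz dw` exist (as Lebesgue integrals). This holds
for every `α ∈ L²` as soon as the sections `k(x_i, ·; ·)` are square integrable, see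
`admissible_of_memLp`. -/
def Admissible (k : EuclideanSpace ℝ (Fin p) → EuclideanSpace ℝ (Fin p) → ℝ → ℝ)
    (x : Fin N → EuclideanSpace ℝ (Fin p)) (α : Coef X W) : Prop :=
  ∀ i, Integrable (fun v : Pt p => α v * k (x i) v.1 v.2) (leb X W)

/-- The prediction `f(x) = ∫ α(z,w) k(x, z; w) dz dw`. -/
def predict (k : EuclideanSpace ℝ (Fin p) → EuclideanSpace ℝ (Fin p) → ℝ → ℝ)
    (α : Coef X W) (x : EuclideanSpace ℝ (Fin p)) : ℝ :=
  ∫ v : Pt p, α v * k x v.1 v.2 ∂(leb X W)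

/-- Feasibility of `(α, ŷ)`: `ŷ_i = f(x_i)` and `c(ŷ_i, y_i) ≤ 0`. -/
def Feasible (k : EuclideanSpace ℝ (Fin p) → EuclideanSpace ℝ (Fin p) → ℝ → ℝ)
    (c : ℝ → ℝ → ℝ) (x : Fin N → EuclideanSpace ℝ (Fin p)) (y : Fin N → ℝ)
    (α : Coef X W) (yhat : Fin N → ℝ) : Prop :=
  Admissible k x α ∧ (∀ i, yhat i = predict k α (x i)) ∧ ∀ i, c (yhat i) (y i) ≤ 0

/-- Slater's condition: some `(α, ŷ)` meets the linear equality constraints, and the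
inequality constraints strictly. -/
def Slater (X : Set (EuclideanSpace ℝ (Fin p))) (W : Set ℝ)
    (k : EuclideanSpace ℝ (Fin p) → EuclideanSpace ℝ (Fin p) → ℝ → ℝ)
    (c : ℝ → ℝ → ℝ) (x : Fin N → EuclideanSpace ℝ (Fin p)) (y : Fin N → ℝ) : Prop :=
  ∃ (α : Coef X W) (yhat : Fin N → ℝ),
    Admissible k x α ∧ (∀ i, yhat i = predict k α (x i)) ∧ ∀ i, c (yhat i) (y i) < 0

/-- The optimal value of the primal problem (an infimum in `[-∞, ∞]`). -/
def primalValue (X : Set (EuclideanSpace ℝ (Fin p))) (W : Set ℝ)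
    (k : EuclideanSpace ℝ (Fin p) → EuclideanSpace ℝ (Fin p) → ℝ → ℝ)
    (c : ℝ → ℝ → ℝ) (x : Fin N → EuclideanSpace ℝ (Fin p)) (y : Fin N → ℝ) (γ : ℝ) : EReal :=
  ⨅ (α : Coef X W) (yhat : Fin N → ℝ) (_ : Feasible k c x y α yhat), (objective γ α : EReal)

/-- The Lagrangian, with multipliers `lam` for `ŷ_i = f(x_i)` and `mu` for
`c(ŷ_i, y_i) ≤ 0`. -/
def lagrangian (k : EuclideanSpace ℝ (Fin p) → EuclideanSpace ℝ (Fin p) → ℝ → ℝ)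
    (c : ℝ → ℝ → ℝ) (x : Fin N → EuclideanSpace ℝ (Fin p)) (y : Fin N → ℝ) (γ : ℝ)
    (α : Coef X W) (yhat lam mu : Fin N → ℝ) : ℝ :=
  objective γ α - ∑ i, lam i * predict k α (x i) + ∑ i, lam i * yhat i
    + ∑ i, mu i * c (yhat i) (y i)

/-- The dual function: the infimum of the Lagrangian over `α` and `ŷ ∈ ℝ^N`. -/
def dualFunction (X : Set (EuclideanSpace ℝ (Fin p))) (W : Set ℝ)
    (k : EuclideanSpace ℝ (Fin p) → EuclideanSpace ℝ (Fin p) → ℝ → ℝ)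
    (c : ℝ → ℝ → ℝ) (x : Fin N → EuclideanSpace ℝ (Fin p)) (y : Fin N → ℝ) (γ : ℝ)
    (lam mu : Fin N → ℝ) : EReal :=
  ⨅ (α : Coef X W) (_ : Admissible k x α) (yhat : Fin N → ℝ),
    (lagrangian k c x y γ α yhat lam mu : EReal)

/-- The optimal value of the dual problem: the supremum of the dual function over `lam ∈ ℝ^N`
and `mu ∈ ℝ^N_+`. -/
def dualValue (X : Set (EuclideanSpace ℝ (Fin p))) (W : Set ℝ)
    (k : EuclideanSpace ℝ (Fin p) → EuclideanSpace ℝ (Fin p) → ℝ → ℝ)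
    (c : ℝ → ℝ → ℝ) (x : Fin N → EuclideanSpace ℝ (Fin p)) (y : Fin N → ℝ) (γ : ℝ) : EReal :=
  ⨆ (lam : Fin N → ℝ) (mu : Fin N → ℝ) (_ : ∀ i, 0 ≤ mu i), dualFunction X W k c x y γ lam mu

/-- For square integrable kernel sections, every `α ∈ L²(X × W)` is admissible. -/
theorem admissible_of_memLp
    (k : EuclideanSpace ℝ (Fin p) → EuclideanSpace ℝ (Fin p) → ℝ → ℝ)
    (x : Fin N → EuclideanSpace ℝ (Fin p))
    (hk : ∀ i, MemLp (fun v : Pt p => k (x i) v.1 v.2) 2 (leb X W)) (α : Coef X W) :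
    Admissible k x α :=
  fun i => (Lp.memLp α).integrable_mul (hk i)

end SFP

end

/-! The objective is not convex, but predictions and objective are all integrals over `X × W` of
functions depending on `α` only pointwise. Lebesgue measure there has no atoms, so splicing two
coefficient functions along a suitable set approximates any convex combination of their
(predictions, objective) pairs. Hence the attainable set in `ℝ^N × ℝ` has convex closure
(`convex_closure_attainable`).

Duality only sees this finite-dimensional set (`exists_multipliers_of_convex_closure`). Passing to
the closure is harmless because strict feasibility is an open condition. One Hahn-Banach separation,
made nondegenerate by Slater's condition, gives `mu`; a second, below the finite convex function `∑
mu i * c (· i) (y i)`, gives `lam`. -/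

namespace SFP

open Filter Topology

/-! ### Splitting vector integrals over an atomless measure -/

section ApproximateLyapunov

variable {Ω E : Type*} [MeasurableSpace Ω] [NormedAddCommGroup E] [NormedSpace ℝ E] [CompleteSpace E]
  {μ : Measure Ω} {T : Ω → ℝ} {θ : ℝ}

/-- The distribution function of a finite measure on `ℝ` without atoms attains every intermediate
value. -/
theorem exists_measureReal_Iic_eq (ν : Measure ℝ) [IsFiniteMeasure ν] [NullSingletonClass ν]
    (hθ₀ : 0 < θ) (hθ₁ : θ < 1) : ∃ r, ν.real (Set.Iic r) = θ * ν.real Set.univ := by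
  rcases (measureReal_nonneg (μ := ν) (s := Set.univ)).eq_or_lt with h0 | hpos
  · exact ⟨0, by
      have := measureReal_mono (μ := ν) (Set.subset_univ (Set.Iic (0 : ℝ)))
      rw [← h0] at this ⊢
      rw [mul_zero]
      exact le_antisymm this measureReal_nonneg⟩
  have hcont : Continuous fun r => ν.real (Set.Iic r) := by
    -- Up to a constant this is the primitive of `1` against `ν`, continuous because `ν` has no
    -- atoms.
    have h : (fun r => ν.real (Set.Iic r)) =
        fun r => ν.real (Set.Iic 0) + ∫ _ in (0 : ℝ)..r, (1 : ℝ) ∂ν := by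
      ext r
      rw [← intervalIntegral.integral_Iic_sub_Iic (integrable_const _).integrableOn
        (integrable_const _).integrableOn]
      simp
    rw [h]
    exact continuous_const.add (intervalIntegral.continuous_primitive
      (fun a b => intervalIntegrable_const) 0)
  have htop : Tendsto (fun r => ν.real (Set.Iic r)) atTop (𝓝 (ν.real Set.univ)) :=
    (ENNReal.tendsto_toReal (measure_ne_top _ _)).comp (tendsto_measure_Iic_atTop ν)
  have hbot : Tendsto (fun r => ν.real (Set.Iic r)) atBot (𝓝 0) := by
    have h := tendsto_measure_iInter_atBot (μ := ν) (fun r : ℝ => nullMeasurableSet_Iic)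
      monotone_Iic ⟨0, measure_ne_top _ _⟩
    have hempty : ⋂ r : ℝ, Set.Iic r = ∅ :=
      Set.eq_empty_of_forall_notMem fun v hv =>
        (sub_one_lt v).not_ge (Set.mem_iInter.1 hv (v - 1))
    rw [hempty, measure_empty] at h
    exact (ENNReal.tendsto_toReal ENNReal.zero_ne_top).comp h
  obtain ⟨a, ha⟩ := (hbot.eventually_lt_const (mul_pos hθ₀ hpos)).exists
  obtain ⟨b, hb⟩ := (htop.eventually_const_lt
    (show θ * ν.real Set.univ < ν.real Set.univ by nlinarith)).exists
  exact mem_range_of_exists_le_of_exists_ge hcont ⟨a, ha.le⟩ ⟨b, hb.le⟩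

/-- A measurable function with null fibres cuts any set in a prescribed proportion. -/
theorem exists_measureReal_inter_le_eq [IsFiniteMeasure μ] (hT : Measurable T)
    (hT0 : ∀ r, μ (T ⁻¹' {r}) = 0) (hθ₀ : 0 < θ) (hθ₁ : θ < 1) (B : Set Ω) :
    ∃ r, μ.real ({v | T v ≤ r} ∩ B) = θ * μ.real B := by
  have : NullSingletonClass ((μ.restrict B).map T) := ⟨fun r => by
    rw [Measure.map_apply hT (measurableSet_singleton r)]
    exact Measure.restrict_le_self.absolutelyContinuous (hT0 r)⟩
  obtain ⟨r, hr⟩ := exists_measureReal_Iic_eq ((μ.restrict B).map T) hθ₀ hθ₁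
  refine ⟨r, ?_⟩
  rw [map_measureReal_apply hT measurableSet_Iic, map_measureReal_apply hT MeasurableSet.univ,
    measureReal_restrict_apply (hT measurableSet_Iic)] at hr
  rwa [Set.preimage_univ, measureReal_restrict_apply_univ] at hr

/-- The integral of a simple function can be split exactly in a prescribed proportion. -/
theorem exists_setIntegral_simpleFunc_eq [IsFiniteMeasure μ] (hT : Measurable T)
    (hT0 : ∀ r, μ (T ⁻¹' {r}) = 0) (hθ₀ : 0 < θ) (hθ₁ : θ < 1) (g : SimpleFunc Ω E)
    (hg : Integrable g μ) :
    ∃ A, MeasurableSet A ∧ ∫ v in A, g v ∂μ = θ • ∫ v, g v ∂μ := by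
  -- Each fibre of `g` gets its own threshold. The fibres are disjoint, so letting the threshold
  -- depend on `g v` cuts all of them in proportion `θ` with a single set.
  choose r hr using fun e : E =>
    exists_measureReal_inter_le_eq hT hT0 hθ₀ hθ₁ (g ⁻¹' {e})
  have hA : MeasurableSet {v | T v ≤ (g.map r) v} :=
    measurableSet_le hT (g.map r).measurable
  refine ⟨_, hA, ?_⟩
  rw [← g.integral_eq_integral hg.integrableOn, ← g.integral_eq_integral hg,
    SimpleFunc.integral_eq, SimpleFunc.integral_eq, Finset.smul_sum]
  refine Finset.sum_congr rfl fun e _ => ?_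
  rw [smul_smul, ← hr e, measureReal_restrict_apply (g.measurableSet_fiber e)]
  congr 2
  ext v
  simp only [Set.mem_inter_iff, Set.mem_preimage, Set.mem_singleton_iff, Set.mem_ofPred_eq,
    SimpleFunc.map_apply]
  constructor
  · rintro ⟨rfl, h⟩; exact ⟨h, rfl⟩
  · rintro ⟨h, rfl⟩; exact ⟨rfl, h⟩

/-- Approximate Lyapunov theorem for the vector measure `A ↦ ∫_A G`. -/
theorem exists_norm_setIntegral_sub_lt [IsFiniteMeasure μ] (hT : Measurable T)
    (hT0 : ∀ r, μ (T ⁻¹' {r}) = 0) (hθ₀ : 0 < θ) (hθ₁ : θ < 1) {G : Ω → E}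
    (hG : Integrable G μ) {ε : ℝ} (hε : 0 < ε) :
    ∃ A, MeasurableSet A ∧ ‖∫ v in A, G v ∂μ - θ • ∫ v, G v ∂μ‖ < ε := by
  -- The error `ε / 2` is paid twice: over `A`, and over the whole space scaled by `θ < 1`.
  obtain ⟨g, hgε, hg⟩ := (memLp_one_iff_integrable.2 hG).exists_simpleFunc_eLpNorm_sub_lt
    ENNReal.one_ne_top (ε := ENNReal.ofReal (ε / 2)) (by simpa using hε)
  rw [memLp_one_iff_integrable] at hg
  have hdiff : Integrable (fun v => G v - g v) μ := hG.sub hg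
  have hnorm : ∫ v, ‖G v - g v‖ ∂μ < ε / 2 := by
    rw [eLpNorm_one_eq_lintegral_enorm] at hgε
    rw [integral_norm_eq_lintegral_enorm hdiff.1]
    exact (ENNReal.toReal_lt_of_lt_ofReal hgε)
  obtain ⟨A, hA, hAg⟩ := exists_setIntegral_simpleFunc_eq hT hT0 hθ₀ hθ₁ g hg
  refine ⟨A, hA, ?_⟩
  have h1 : ‖∫ v in A, (G v - g v) ∂μ‖ < ε / 2 :=
    ((norm_integral_le_integral_norm _).trans
      (setIntegral_le_integral hdiff.norm (ae_of_all _ fun _ => norm_nonneg _))).trans_lt hnorm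
  have h2 : ‖θ • ∫ v, (G v - g v) ∂μ‖ < ε / 2 := by
    rw [norm_smul, Real.norm_of_nonneg hθ₀.le]
    have := (norm_integral_le_integral_norm fun v => G v - g v).trans_lt hnorm
    nlinarith [norm_nonneg (∫ v, (G v - g v) ∂μ)]
  have h3 : ∫ v in A, G v ∂μ - θ • ∫ v, G v ∂μ =
      ∫ v in A, (G v - g v) ∂μ - θ • ∫ v, (G v - g v) ∂μ := by
    rw [integral_sub hG.integrableOn hg.integrableOn, integral_sub hG hg, hAg, smul_sub]
    abel
  rw [h3]
  linarith [norm_sub_le (∫ v in A, (G v - g v) ∂μ) (θ • ∫ v, (G v - g v) ∂μ)]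

/-- Convex combinations of two integrals are approximated by integrating one function on a set and
the other one on its complement. -/
theorem exists_norm_piecewise_integral_sub_lt [IsFiniteMeasure μ] (hT : Measurable T)
    (hT0 : ∀ r, μ (T ⁻¹' {r}) = 0) {a b : ℝ} (ha : 0 < a) (hb : 0 < b) (hab : a + b = 1)
    {G H : Ω → E} (hG : Integrable G μ) (hH : Integrable H μ) {ε : ℝ} (hε : 0 < ε) :
    ∃ A, MeasurableSet A ∧
      ‖∫ v in A, G v ∂μ + ∫ v in Aᶜ, H v ∂μ - (a • ∫ v, G v ∂μ + b • ∫ v, H v ∂μ)‖ < ε := by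
  -- Splitting `G - H` suffices, since `∫_A G + ∫_{Aᶜ} H = ∫_A (G - H) + ∫ H`.
  obtain ⟨A, hA, h⟩ := exists_norm_setIntegral_sub_lt hT hT0 ha (by linarith) (hG.sub hH) hε
  refine ⟨A, hA, ?_⟩
  convert h using 2
  obtain rfl : b = 1 - a := by linarith
  simp only [Pi.sub_apply]
  rw [integral_sub hG.integrableOn hH.integrableOn, integral_sub hG hH,
    ← integral_add_compl hA hH]
  module

end ApproximateLyapunov

/-! ### Lagrange multipliers by separation in `ℝ^N × ℝ` -/

section ConvexDuality

variable {N : ℕ}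

/-- A continuous linear functional on `ℝ^N × ℝ` in coordinates. -/
theorem strongDual_apply_eq (f : StrongDual ℝ ((Fin N → ℝ) × ℝ)) (v : Fin N → ℝ) (t : ℝ) :
    f (v, t) = ∑ i, f (Pi.single i 1, 0) * v i + f (0, 1) * t := by
  have h : (v, t) = ∑ i, v i • ((Pi.single i 1, 0) : (Fin N → ℝ) × ℝ) + t • (0, 1) := by
    ext j <;> simp [Prod.fst_sum, Prod.snd_sum, Finset.sum_apply, Pi.single_apply]
  rw [h, map_add, map_sum]
  simp only [map_smul, smul_eq_mul, mul_comm]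

/-- Multipliers of the inequality constraints under Slater's condition. -/
theorem exists_inequality_multipliers {K : Set ((Fin N → ℝ) × ℝ)} (hK : Convex ℝ K)
    {φ : Fin N → ℝ → ℝ} (hφ : ∀ i, ConvexOn ℝ Set.univ (φ i))
    {s₀ : (Fin N → ℝ) × ℝ} (hs₀ : s₀ ∈ K) (hslater : ∀ i, φ i (s₀.1 i) < 0) {P : ℝ}
    (hP : ∀ s ∈ K, (∀ i, φ i (s.1 i) < 0) → P ≤ s.2) :
    ∃ m : Fin N → ℝ, (∀ i, 0 ≤ m i) ∧ ∀ s ∈ K, P ≤ s.2 + ∑ i, m i * φ i (s.1 i) := by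
  set B : Set ((Fin N → ℝ) × ℝ) := {q | ∃ s ∈ K, (∀ i, φ i (s.1 i) ≤ q.1 i) ∧ s.2 ≤ q.2} with hB
  set O : Set ((Fin N → ℝ) × ℝ) := (Set.univ.pi fun _ => Set.Iio 0) ×ˢ Set.Iio P with hO
  have hOo : IsOpen O := (isOpen_set_pi Set.finite_univ fun _ _ => isOpen_Iio).prod isOpen_Iio
  have hOc : Convex ℝ O := (convex_pi fun _ _ => convex_Iio 0).prod (convex_Iio P)
  have hBc : Convex ℝ B := by
    rintro q ⟨s, hs, hsq, hsq'⟩ q' ⟨s', hs', hsq₂, hsq₂'⟩ a b ha hb hab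
    refine ⟨a • s + b • s', hK hs hs' ha hb hab, fun i => ?_, ?_⟩
    · refine ((hφ i).2 (Set.mem_univ (s.1 i)) (Set.mem_univ (s'.1 i)) ha hb hab).trans ?_
      exact add_le_add (mul_le_mul_of_nonneg_left (hsq i) ha)
        (mul_le_mul_of_nonneg_left (hsq₂ i) hb)
    · exact add_le_add (mul_le_mul_of_nonneg_left hsq' ha) (mul_le_mul_of_nonneg_left hsq₂' hb)
  have hdisj : Disjoint O B := by
    rw [Set.disjoint_left]
    rintro q ⟨hq, hq'⟩ ⟨s, hs, h, h'⟩
    exact (hP s hs fun i => (h i).trans_lt (hq i trivial)).not_gt (h'.trans_lt hq')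
  obtain ⟨f, u, hfO, hfB⟩ := geometric_hahn_banach_open hOc hOo hBc hdisj
  have hcl : closure O = (Set.univ.pi fun _ => Set.Iic 0) ×ˢ Set.Iic P := by
    simp [hO, closure_prod_eq, closure_pi_set]
  -- The corner `(0, P)`, where the bound is needed, lies only in the closure of `O`.
  have hfcl : ∀ q : (Fin N → ℝ) × ℝ, (∀ i, q.1 i ≤ 0) → q.2 ≤ P → f q ≤ u := by
    intro q hq hq'
    have hmem : q ∈ closure O := by
      rw [hcl]; exact ⟨fun i _ => hq i, hq'⟩
    exact closure_minimal (fun a ha => (hfO a ha).le)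
      (isClosed_le f.continuous continuous_const) hmem
  set m : Fin N → ℝ := fun i => f (Pi.single i 1, 0) with hm
  set r : ℝ := f (0, 1) with hr
  have hf : ∀ v t, f (v, t) = ∑ i, m i * v i + r * t := strongDual_apply_eq f
  -- a functional bounded above on a translated cone is nonpositive on the cone
  have hcone : ∀ d : (Fin N → ℝ) × ℝ, (∀ i, d.1 i ≤ 0) → d.2 ≤ 0 → f d ≤ 0 := by
    intro d hd hd'
    by_contra! hpos
    obtain ⟨n, hn⟩ := exists_nat_gt ((u - f (0, P)) / f d)
    rw [div_lt_iff₀ hpos] at hn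
    have := hfcl ((0, P) + (n : ℝ) • d)
      (fun i => by simpa using mul_nonpos_of_nonneg_of_nonpos n.cast_nonneg (hd i))
      (by simpa using mul_nonpos_of_nonneg_of_nonpos n.cast_nonneg hd')
    rw [map_add, map_smul, smul_eq_mul] at this
    linarith
  have hm0 : ∀ i, 0 ≤ m i := fun i => by
    have := hcone (-(Pi.single i 1, 0)) (fun j => by
      by_cases h : j = i <;> simp [h]) (by simp)
    rw [map_neg] at this
    linarith
  have hr0 : 0 ≤ r := by
    have := hcone (-(0, 1)) (fun j => by simp) (by simp)
    rw [map_neg] at this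
    linarith
  have hmain : ∀ s ∈ K, r * P ≤ ∑ i, m i * φ i (s.1 i) + r * s.2 := fun s hs => by
    have h1 := hfB (fun i => φ i (s.1 i), s.2) ⟨s, hs, fun _ => le_rfl, le_rfl⟩
    have h2 := hfcl (0, P) (fun _ => le_rfl) le_rfl
    rw [hf] at h1 h2
    simp only [Pi.zero_apply, mul_zero, Finset.sum_const_zero, zero_add] at h2
    linarith
  -- If `r = 0`, then at the Slater point a sum of nonpositive terms is nonnegative, so every `m i`
  -- vanishes; then `f = 0`, which separates nothing strictly.
  have hrpos : 0 < r := by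
    refine hr0.lt_of_ne' fun hr' => ?_
    have h1 := hmain s₀ hs₀
    rw [hr'] at h1
    simp only [zero_mul, add_zero] at h1
    have h2 : ∀ i ∈ Finset.univ, m i * φ i (s₀.1 i) ≤ 0 := fun i _ =>
      mul_nonpos_of_nonneg_of_nonpos (hm0 i) (hslater i).le
    have h3 := (Finset.sum_eq_zero_iff_of_nonpos h2).1 (le_antisymm (Finset.sum_nonpos h2) h1)
    have h4 : ∀ i, m i = 0 := fun i =>
      (mul_eq_zero.1 (h3 i (Finset.mem_univ i))).resolve_right (hslater i).ne
    have h5 := hfO (fun _ => -1, P - 1) ⟨fun _ _ => by simp, by simp⟩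
    have h6 := hfB (fun i => φ i (s₀.1 i), s₀.2) ⟨s₀, hs₀, fun _ => le_rfl, le_rfl⟩
    rw [hf] at h5 h6
    simp only [h4, hr', zero_mul, Finset.sum_const_zero, add_zero] at h5 h6
    linarith
  refine ⟨fun i => m i / r, fun i => div_nonneg (hm0 i) hr0, fun s hs => ?_⟩
  have h := hmain s hs
  have h' : ∑ i, m i / r * φ i (s.1 i) = (∑ i, m i * φ i (s.1 i)) / r := by
    rw [Finset.sum_div]
    exact Finset.sum_congr rfl fun i _ => by ring
  rw [h', ← mul_le_mul_iff_right₀ hrpos, mul_add, mul_div_cancel₀ _ hrpos.ne']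
  linarith

/-- Sandwich theorem: a convex function that dominates a convex set of points from above
is separated from it by an affine function. -/
theorem exists_affine_separation {K : Set ((Fin N → ℝ) × ℝ)} (hK : Convex ℝ K)
    (hKne : K.Nonempty) {h : (Fin N → ℝ) → ℝ} (hh : ConvexOn ℝ Set.univ h) {P : ℝ}
    (hP : ∀ s ∈ K, P ≤ s.2 + h s.1) :
    ∃ l : Fin N → ℝ, ∀ s ∈ K, ∀ z,
      P ≤ s.2 - ∑ i, l i * s.1 i + ∑ i, l i * z i + h z := by
  have hcont : Continuous h := continuousOn_univ.1 (hh.continuousOn isOpen_univ)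
  -- The strict epigraph of `h` is separated from the reflection `t ↦ P - t` of `K`, which lies on
  -- or below the graph of `h`.
  set O : Set ((Fin N → ℝ) × ℝ) := {q | h q.1 < q.2} with hO
  have hOo : IsOpen O := isOpen_lt (hcont.comp continuous_fst) continuous_snd
  have hOc : Convex ℝ O := by simpa using hh.convex_strict_epigraph
  set B : Set ((Fin N → ℝ) × ℝ) := {q | (q.1, P - q.2) ∈ K} with hB
  have hBc : Convex ℝ B := by
    intro q hq q' hq' a b ha hb hab
    have := hK hq hq' ha hb hab
    simp only [hB, Set.mem_ofPred_eq]
    convert this using 1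
    ext
    · simp
    · simp only [Prod.snd_add, Prod.smul_snd, smul_eq_mul]
      linear_combination (-P) * hab
  have hdisj : Disjoint O B := by
    rw [Set.disjoint_left]
    intro q hq hq'
    have h1 := hP _ hq'
    have h2 : h q.1 < q.2 := hq
    simp only at h1
    linarith
  obtain ⟨f, u, hfO, hfB⟩ := geometric_hahn_banach_open hOc hOo hBc hdisj
  set m : Fin N → ℝ := fun i => f (Pi.single i 1, 0) with hm
  set r : ℝ := f (0, 1) with hr
  have hf : ∀ v t, f (v, t) = ∑ i, m i * v i + r * t := strongDual_apply_eq f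
  have hmemB : ∀ s ∈ K, u ≤ ∑ i, m i * s.1 i + r * (P - s.2) := fun s hs => by
    have := hfB (s.1, P - s.2) (by simpa [hB] using hs)
    rwa [hf] at this
  have hmemO : ∀ z t, h z < t → ∑ i, m i * z i + r * t < u := fun z t hzt => by
    have := hfO (z, t) hzt
    rwa [hf] at this
  obtain ⟨s₀, hs₀⟩ := hKne
  -- The hyperplane is not vertical: `h` is finite everywhere, so the vertical line through `s₀.1`
  -- meets both sets. No further constraint qualification is needed.
  have hrneg : r < 0 := by
    have h1 := hmemB s₀ hs₀
    have h2 := hP s₀ hs₀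
    have h3 := hmemO s₀.1 (h s₀.1 + 1) (by linarith)
    nlinarith
  have hle : ∀ z, ∑ i, m i * z i + r * h z ≤ u := fun z => by
    by_contra! hlt
    -- The height at which the functional equals exactly `u`, contradicting strictness on `O`.
    have h1 := hmemO z (h z + (∑ i, m i * z i + r * h z - u) / (-r))
      (by linarith [div_pos (sub_pos.2 hlt) (neg_pos.2 hrneg)])
    have h2 : r * ((∑ i, m i * z i + r * h z - u) / (-r)) = -(∑ i, m i * z i + r * h z - u) := by
      rw [div_neg, mul_neg, mul_div_cancel₀ _ hrneg.ne]
    rw [mul_add, h2] at h1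
    linarith
  refine ⟨fun i => m i / r, fun s hs z => ?_⟩
  have hsum : ∀ v : Fin N → ℝ, ∑ i, m i / r * v i = (∑ i, m i * v i) / r := fun v => by
    rw [Finset.sum_div]
    exact Finset.sum_congr rfl fun i _ => by ring
  have h1 := hmemB s hs
  have h2 := hle z
  rw [hsum, hsum, ← mul_le_mul_left_of_neg hrneg]
  have h3 : r * (s.2 - (∑ i, m i * s.1 i) / r + (∑ i, m i * z i) / r + h z) =
      r * s.2 - ∑ i, m i * s.1 i + ∑ i, m i * z i + r * h z := by
    rw [mul_add, mul_add, mul_sub, mul_div_cancel₀ _ hrneg.ne, mul_div_cancel₀ _ hrneg.ne]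
  rw [h3]
  linarith

/-- Strong duality for a set whose closure is convex. -/
theorem exists_multipliers_of_convex_closure {S : Set ((Fin N → ℝ) × ℝ)}
    (hS : Convex ℝ (closure S)) {φ : Fin N → ℝ → ℝ} (hφ : ∀ i, ConvexOn ℝ Set.univ (φ i))
    {s₀ : (Fin N → ℝ) × ℝ} (hs₀ : s₀ ∈ S) (hslater : ∀ i, φ i (s₀.1 i) < 0) {P : ℝ}
    (hP : ∀ s ∈ S, (∀ i, φ i (s.1 i) ≤ 0) → P ≤ s.2) :
    ∃ l m : Fin N → ℝ, (∀ i, 0 ≤ m i) ∧ ∀ s ∈ S, ∀ z : Fin N → ℝ,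
      P ≤ s.2 - ∑ i, l i * s.1 i + ∑ i, l i * z i + ∑ i, m i * φ i (z i) := by
  have hcont : ∀ i, Continuous (φ i) := fun i =>
    continuousOn_univ.1 ((hφ i).continuousOn isOpen_univ)
  -- A strictly feasible limit point with value below `P` has a neighbourhood of such points, hence
  -- one in `S`.
  have hP' : ∀ s ∈ closure S, (∀ i, φ i (s.1 i) < 0) → P ≤ s.2 := by
    intro s hs hneg
    by_contra! hlt
    have hopen : IsOpen ((⋂ i, {q : (Fin N → ℝ) × ℝ | φ i (q.1 i) < 0}) ∩ {q | q.2 < P}) := by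
      refine (isOpen_iInter_of_finite fun i => isOpen_lt ?_ continuous_const).inter
        (isOpen_lt continuous_snd continuous_const)
      exact (hcont i).comp ((continuous_apply i).comp continuous_fst)
    obtain ⟨q, ⟨hq, hq'⟩, hqS⟩ :=
      mem_closure_iff.1 hs _ hopen ⟨Set.mem_iInter.2 hneg, hlt⟩
    exact (hP q hqS fun i => (Set.mem_iInter.1 hq i).le).not_gt hq'
  obtain ⟨m, hm, hmP⟩ := exists_inequality_multipliers hS hφ (subset_closure hs₀) hslater hP'
  have hconv : ConvexOn ℝ Set.univ fun z : Fin N → ℝ => ∑ i, m i * φ i (z i) := by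
    refine ⟨convex_univ, fun z _ z' _ a b ha hb hab => ?_⟩
    simp only [smul_eq_mul, Finset.mul_sum, ← Finset.sum_add_distrib]
    refine Finset.sum_le_sum fun i _ => ?_
    have := mul_le_mul_of_nonneg_left
      ((hφ i).2 (Set.mem_univ (z i)) (Set.mem_univ (z' i)) ha hb hab) (hm i)
    simp only [smul_eq_mul] at this
    simp only [Pi.add_apply, Pi.smul_apply, smul_eq_mul]
    linarith
  obtain ⟨l, hl⟩ := exists_affine_separation hS ⟨_, subset_closure hs₀⟩ hconv hmP
  exact ⟨l, m, hm, fun s hs z => hl s (subset_closure hs) z⟩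

end ConvexDuality

/-! ### Application to the sparse functional program -/

section SparseProgram

variable {p N : ℕ} {X : Set (EuclideanSpace ℝ (Fin p))} {W : Set ℝ}
  {k : EuclideanSpace ℝ (Fin p) → EuclideanSpace ℝ (Fin p) → ℝ → ℝ} {c : ℝ → ℝ → ℝ}
  {x : Fin N → EuclideanSpace ℝ (Fin p)} {y : Fin N → ℝ} {γ : ℝ}

/-- The integrand of the predictions and of the objective when the coefficient at `v` is `a`. -/
noncomputable def density (k : EuclideanSpace ℝ (Fin p) → EuclideanSpace ℝ (Fin p) → ℝ → ℝ)
    (x : Fin N → EuclideanSpace ℝ (Fin p)) (γ a : ℝ) (v : Pt p) : (Fin N → ℝ) × ℝ :=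
  (fun i => a * k (x i) v.1 v.2, 1 / 2 * a ^ 2 + γ * Set.indicator {0}ᶜ (fun _ => 1) a)

/-- The attainable pairs of predictions and objective values. -/
def attainable (X : Set (EuclideanSpace ℝ (Fin p))) (W : Set ℝ)
    (k : EuclideanSpace ℝ (Fin p) → EuclideanSpace ℝ (Fin p) → ℝ → ℝ)
    (x : Fin N → EuclideanSpace ℝ (Fin p)) (γ : ℝ) : Set ((Fin N → ℝ) × ℝ) :=
  {s | ∃ α : Coef X W, Admissible k x α ∧ s = (fun i => predict k α (x i), objective γ α)}

theorem isFiniteMeasure_leb (hX : IsCompact X) (hW : IsCompact W) :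
    IsFiniteMeasure (leb X W) :=
  ⟨by simpa using (hX.prod hW).measure_lt_top⟩

/-- The coordinate `w` thus serves as the slicing function `T`, even when `p = 0`. -/
theorem leb_preimage_snd_singleton (r : ℝ) : leb X W (Prod.snd ⁻¹' {r}) = 0 := by
  refine Measure.restrict_le_self.absolutelyContinuous ?_
  rw [← Set.univ_prod, Measure.volume_eq_prod, Measure.prod_prod]
  simp

theorem measurableSet_coef_ne_zero (α : Coef X W) : MeasurableSet {v | α v ≠ 0} :=
  (Lp.stronglyMeasurable α).measurable (measurableSet_singleton 0).compl

theorem integrable_sq (α : Coef X W) : Integrable (fun v => α v ^ 2) (leb X W) :=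
  (Lp.memLp α).integrable_sq

theorem norm_sq_eq_integral (α : Coef X W) : ‖α‖ ^ 2 = ∫ v, α v ^ 2 ∂(leb X W) := by
  rw [← real_inner_self_eq_norm_sq, L2.inner_def]
  simp [sq]

theorem indicator_comp_eq (α : Coef X W) :
    (fun v => Set.indicator {0}ᶜ (fun _ => (1 : ℝ)) (α v)) =
      Set.indicator {v | α v ≠ 0} fun _ => 1 := by
  ext v
  simp [Set.indicator_apply]

theorem integrable_indicator_comp [IsFiniteMeasure (leb X W)] (α : Coef X W) :
    Integrable (fun v => Set.indicator {0}ᶜ (fun _ => (1 : ℝ)) (α v)) (leb X W) := by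
  rw [indicator_comp_eq]
  exact (integrable_const 1).indicator (measurableSet_coef_ne_zero α)

theorem integrable_objective [IsFiniteMeasure (leb X W)] (γ : ℝ) (α : Coef X W) :
    Integrable (fun v => 1 / 2 * α v ^ 2 + γ * Set.indicator {0}ᶜ (fun _ => (1 : ℝ)) (α v))
      (leb X W) :=
  ((integrable_sq α).const_mul _).add ((integrable_indicator_comp α).const_mul _)

/-- Written as an integral, the nonconvex objective becomes additive over a partition of the domain,
as splicing requires. -/
theorem integral_objective [IsFiniteMeasure (leb X W)] (γ : ℝ) (α : Coef X W) :
    ∫ v, (1 / 2 * α v ^ 2 + γ * Set.indicator {0}ᶜ (fun _ => (1 : ℝ)) (α v)) ∂(leb X W) =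
      objective γ α := by
  rw [integral_add ((integrable_sq α).const_mul _) ((integrable_indicator_comp α).const_mul _),
    integral_const_mul, integral_const_mul, ← norm_sq_eq_integral, indicator_comp_eq,
    integral_indicator_const _ (measurableSet_coef_ne_zero α)]
  simp [objective, l0]

theorem integrable_density [IsFiniteMeasure (leb X W)] {α : Coef X W} (hα : Admissible k x α) :
    Integrable (fun v => density k x γ (α v) v) (leb X W) :=
  (Integrable.of_eval hα).prodMk (integrable_objective γ α)

theorem integral_density [IsFiniteMeasure (leb X W)] {α : Coef X W} (hα : Admissible k x α) :
    ∫ v, density k x γ (α v) v ∂(leb X W) = (fun i => predict k α (x i), objective γ α) := by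
  unfold density
  rw [integral_pair (Integrable.of_eval hα) (integrable_objective γ α), integral_objective]
  congr 1
  ext i
  exact eval_integral hα i

/-- Coefficients that agree with `α` on `A` and with `β` off `A`. -/
theorem exists_splice [IsFiniteMeasure (leb X W)] {α β : Coef X W} (hα : Admissible k x α)
    (hβ : Admissible k x β) {A : Set (Pt p)} (hA : MeasurableSet A) :
    ∃ δ : Coef X W, Admissible k x δ ∧ ∫ v, density k x γ (δ v) v ∂(leb X W) =
      ∫ v in A, density k x γ (α v) v ∂(leb X W) +
        ∫ v in Aᶜ, density k x γ (β v) v ∂(leb X W) := by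
  classical
  have hmem : MemLp (A.piecewise α β) 2 (leb X W) :=
    MemLp.piecewise hA ((Lp.memLp α).restrict A) ((Lp.memLp β).restrict Aᶜ)
  refine ⟨hmem.toLp, fun i => ?_, ?_⟩
  · refine (Integrable.piecewise hA (hα i).integrableOn (hβ i).integrableOn).congr ?_
    filter_upwards [hmem.coeFn_toLp] with v hv
    rw [hv]
    by_cases h : v ∈ A <;> simp [h]
  · rw [← integral_piecewise hA (integrable_density hα).integrableOn
      (integrable_density hβ).integrableOn]
    refine integral_congr_ae ?_
    filter_upwards [hmem.coeFn_toLp] with v hv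
    rw [hv]
    by_cases h : v ∈ A <;> simp [h]

/-- The attainable set has convex closure, although the objective is not convex. -/
theorem convex_closure_attainable (hX : IsCompact X) (hW : IsCompact W) :
    Convex ℝ (closure (attainable X W k x γ)) := by
  have := isFiniteMeasure_leb hX hW
  have hseg : ∀ s ∈ attainable X W k x γ, ∀ t ∈ attainable X W k x γ, ∀ a b : ℝ, 0 < a → 0 < b →
      a + b = 1 → a • s + b • t ∈ closure (attainable X W k x γ) := by
    rintro _ ⟨α, hα, rfl⟩ _ ⟨β, hβ, rfl⟩ a b ha hb hab
    rw [Metric.mem_closure_iff]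
    intro ε hε
    obtain ⟨A, hA, h⟩ := exists_norm_piecewise_integral_sub_lt (μ := leb X W) measurable_snd
      leb_preimage_snd_singleton ha hb hab (integrable_density (γ := γ) hα)
      (integrable_density (γ := γ) hβ) hε
    obtain ⟨δ, hδ, hint⟩ := exists_splice (γ := γ) hα hβ hA
    refine ⟨_, ⟨δ, hδ, rfl⟩, ?_⟩
    rwa [← hint, integral_density hα, integral_density hβ, integral_density hδ, ← dist_eq_norm,
      dist_comm] at h
  rw [convex_iff_forall_pos]
  intro s hs t ht a b ha hb hab
  -- Combinations of attainable points are only known to lie in the closure; continuity extends this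
  -- to limit points.
  have := map_mem_closure₂ (f := fun s t : (Fin N → ℝ) × ℝ => a • s + b • t) (by fun_prop) hs ht
    (u := closure (attainable X W k x γ)) fun s hs t ht => hseg s hs t ht a b ha hb hab
  rwa [closure_closure] at this

theorem objective_nonneg (hγ : 0 ≤ γ) (α : Coef X W) : 0 ≤ objective γ α :=
  add_nonneg (by positivity) (mul_nonneg hγ measureReal_nonneg)

/-- Weak duality: at a feasible pair the `lam` terms cancel and the `mu` term is nonpositive. -/
theorem dualValue_le_primalValue : dualValue X W k c x y γ ≤ primalValue X W k c x y γ := by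
  refine iSup_le fun l => iSup_le fun m => iSup_le fun hm => le_iInf fun α => le_iInf fun z =>
    le_iInf fun hz => ?_
  refine (iInf_le_of_le α (iInf_le_of_le hz.1 (iInf_le _ z))).trans (EReal.coe_le_coe_iff.2 ?_)
  have h : ∑ i, m i * c (z i) (y i) ≤ 0 := Finset.sum_nonpos fun i _ =>
    mul_nonpos_of_nonneg_of_nonpos (hm i) (hz.2.2 i)
  have h' : ∑ i, l i * predict k α (x i) = ∑ i, l i * z i :=
    Finset.sum_congr rfl fun i _ => by rw [hz.2.1 i]
  unfold lagrangian
  linarith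

theorem exists_primalValue_eq (hγ : 0 ≤ γ) (hS : Slater X W k c x y) :
    ∃ P : ℝ, primalValue X W k c x y γ = P := by
  obtain ⟨α, z, hα, hz, hlt⟩ := hS
  have hle : primalValue X W k c x y γ ≤ (objective γ α : EReal) :=
    iInf_le_of_le α (iInf_le_of_le z (iInf_le _ ⟨hα, hz, fun i => (hlt i).le⟩))
  have hge : ((0 : ℝ) : EReal) ≤ primalValue X W k c x y γ :=
    le_iInf fun β => le_iInf fun _ => le_iInf fun _ =>
      EReal.coe_le_coe_iff.2 (objective_nonneg hγ β)
  exact ⟨_, (EReal.coe_toReal (ne_top_of_le_ne_top (EReal.coe_ne_top _) hle)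
    (ne_bot_of_le_ne_bot (EReal.coe_ne_bot _) hge)).symm⟩

/-- A single pair of multipliers keeps the Lagrangian above `P` for all admissible `α` and all `ŷ`.
-/
theorem le_dualValue (hX : IsCompact X) (hW : IsCompact W)
    (hc : ∀ i, ConvexOn ℝ Set.univ (fun t : ℝ => c t (y i))) (hS : Slater X W k c x y) {P : ℝ}
    (hP : (P : EReal) ≤ primalValue X W k c x y γ) :
    (P : EReal) ≤ dualValue X W k c x y γ := by
  obtain ⟨α, z, hα, hz, hlt⟩ := hS
  obtain ⟨l, m, hm, h⟩ := exists_multipliers_of_convex_closure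
    (convex_closure_attainable (γ := γ) hX hW) hc (P := P) ⟨α, hα, rfl⟩
    (fun i => by simpa [hz i] using hlt i) (by
      rintro _ ⟨β, hβ, rfl⟩ hle
      exact EReal.coe_le_coe_iff.1 (hP.trans (iInf_le_of_le β (iInf_le_of_le _
        (iInf_le _ ⟨hβ, fun _ => rfl, hle⟩)))))
  refine le_iSup_of_le l (le_iSup_of_le m (le_iSup_of_le hm ?_))
  exact le_iInf fun β => le_iInf fun hβ => le_iInf fun z =>
    EReal.coe_le_coe_iff.2 (h _ ⟨β, hβ, rfl⟩ z)

end SparseProgram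

end SFP

theorem theorem1 {p N : ℕ}
    (X : Set (EuclideanSpace ℝ (Fin p))) (hX : IsCompact X)
    (W : Set ℝ) (hW : IsCompact W)
    (k : EuclideanSpace ℝ (Fin p) → EuclideanSpace ℝ (Fin p) → ℝ → ℝ)
    (c : ℝ → ℝ → ℝ)
    (x : Fin N → EuclideanSpace ℝ (Fin p)) (hx : ∀ i, x i ∈ X)
    (y : Fin N → ℝ) (γ : ℝ) (hγ : 0 ≤ γ)
    -- the loss is convex in the prediction
    (hc : ∀ i, ConvexOn ℝ Set.univ (fun t : ℝ => c t (y i)))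
    -- the kernel sections are genuine measurable functions (densities with respect to `dz dw`)
    (hk : ∀ i, AEStronglyMeasurable (fun v : SFP.Pt p => k (x i) v.1 v.2) (SFP.leb X W))
    (hS : SFP.Slater X W k c x y) :
    ∃ P D : ℝ, SFP.primalValue X W k c x y γ = (P : EReal) ∧
      SFP.dualValue X W k c x y γ = (D : EReal) ∧ P - D = 0 := by
  obtain ⟨P, hP⟩ := SFP.exists_primalValue_eq hγ hS
  refine ⟨P, P, hP, le_antisymm ?_ (SFP.le_dualValue hX hW hc hS hP.ge), sub_self P⟩
  exact SFP.dualValue_le_primalValue.trans hP.le
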